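/- Let $n\ge 4$. Let $\mathbf C_n=(\{0,1,\dots,n-1\};\wedge,\vee,\to,\bot,\top)$ be the $n$-element Heyting chain $0<1<\dots<n-1$, and let $\mathcal G_n=\mathbb{ISP}(\mathbf C_n)$ be the class of Heyting algebras isomorphic to a subalgebra of a power of $\mathbf C_n$. For $1\le i\le n-3$ let $g_i$ be the partial endomorphism of $\mathbf C_n$ with domain $\{0,\dots,n-1\}\setminus\{i\}$ given by $g_i(i+1)=i$ and $g_i(x)=x$ for $x\ne i+1$; let $h_1$ be the endomorphism with $h_1(x)=x+1$ if $1\le x<n-1$ and $h_1(x)=x$ otherwise; and let $\sigma=(g_1,\dots,g_{n-3},h_1)$. For $\mathbf A\in\mathcal G_n$ let $D^\sigma(\mathbf A)$ be the set of homomorphisms $\mathbf A\to\mathbf C_n$, with the topology induced from the product $\{0,\dots,n-1\}^A$ of discrete spaces, and with the operations of $\sigma$ lifted pointwise: $g_i$ is defined at $x$ if and only if $i\notin x(A)$, with value $g_i\circ x$, and $h_1$ sends $x$ to $h_1\circ x$. For a homomorphism $f\colon\mathbf A\to\mathbf B$ let $D^\sigma(f)\colon D^\sigma(\mathbf B)\to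 D^\sigma(\mathbf A)$, $x\mapsto x\circ f$. On $X=D^\sigma(\mathbf A)$ write $x\simeq_X y$ if $x=y$ or there is a finite sequence $z_0=x,\dots,z_N=y$ in $X$ such that for each $j<N$ there is $i\in\{1,\dots,n-3\}$ with $z_{j+1}=g_i\circ z_j$ or $z_j=g_i\circ z_{j+1}$ (with the right-hand side defined). Let $\mathbf A,\mathbf B,\mathbf C\in\mathcal G_n$ and let $f_B\colon\mathbf A\to\mathbf B$ and $f_C\colon\mathbf A\to\mathbf C$ be injective homomorphisms (a V-formation in $\mathcal G_n$). Then the following are equivalent. (1) The V-formation admits amalgamation in $\mathcal G_n$: there are $\mathbf D\in\mathcal G_n$ and injective homomorphisms $h_B\colon\mathbf B\to\mathbf D$, $h_C\colon\mathbf C\to\mathbf D$ with $h_B\circ f_B=h_C\circ f_C$. (2) Both of the following hold: (a) for each $x\in D^\sigma(\mathbf B)$ there exist $y\in D^\sigma(\mathbf B)$ and $z\in D^\sigma(\mathbf C)$ such that $x\simeq_{D^\sigma(\mathbf B)}y$ and $D^\sigma(f_B)(y)=D^\sigma(f_C)(z)$; (b) for each $x'\in D^\sigma(\mathbf C)$ there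 exist $y'\in D^\sigma(\mathbf C)$ and $z'\in D^\sigma(\mathbf B)$ such that $x'\simeq_{D^\sigma(\mathbf C)}y'$ and $D^\sigma(f_C)(y')=D^\sigma(f_B)(z')$. -/

import Mathlib

universe u

namespace Goedel

/-! Finite Heyting chains, with universe `Fin n`, i.e. `0 < 1 < ⋯ < n - 1`. -/

/-- The implication of the `n`-element Heyting chain. -/
theorem chain_himp {n : ℕ} [NeZero n] (a b : Fin n) :
    a ⇨ b = if a ≤ b then ⊤ else b := rfl

theorem chain_bot_val {n : ℕ} [NeZero n] : ((⊥ : Fin n) : ℕ) = 0 := rfl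

theorem chain_top_val {n : ℕ} [NeZero n] : ((⊤ : Fin n) : ℕ) = n - 1 := by
  have h : (⟨n - 1, Nat.sub_lt (NeZero.pos n) one_pos⟩ : Fin n) ≤ ⊤ := le_top
  have h' : n - 1 ≤ ((⊤ : Fin n) : ℕ) := h
  have := (⊤ : Fin n).isLt
  omega

/-- The class `ISP(C_n)`: the Heyting algebras isomorphic to a subalgebra of a power of the
`n`-element Heyting chain (i.e. admitting an embedding into such a power). -/
def InG (n : ℕ) [NeZero n] (A : Type u) [HeytingAlgebra A] : Prop :=
  ∃ (I : Type u) (e : HeytingHom A (I → Fin n)), Function.Injective e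

/-- The V-formation `B ← A → C` admits amalgamation in the class `ISP(C_n)`. -/
def AdmitsAmalgamation (n : ℕ) [NeZero n] {A B C : Type u} [HeytingAlgebra A]
    [HeytingAlgebra B] [HeytingAlgebra C] (fB : HeytingHom A B) (fC : HeytingHom A C) : Prop :=
  ∃ (D : Type u) (_ : HeytingAlgebra D), InG n D ∧
    ∃ (hB : HeytingHom B D) (hC : HeytingHom C D),
      Function.Injective hB ∧ Function.Injective hC ∧ hB.comp fB = hC.comp fC

/-! Partial endomorphisms and alter egos. -/

/-- A partial endomorphism of a Heyting algebra `L`: a homomorphism into `L` from a subalgebra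
of `L`; equivalently a partial function whose graph is a subalgebra of `L × L`. -/
structure PartialEndo (L : Type) [HeytingAlgebra L] where
  toPFun : L →. L
  bot_mem : ⊥ ∈ toPFun ⊥
  top_mem : ⊤ ∈ toPFun ⊤
  inf_mem : ∀ {a b a' b' : L}, a' ∈ toPFun a → b' ∈ toPFun b → a' ⊓ b' ∈ toPFun (a ⊓ b)
  sup_mem : ∀ {a b a' b' : L}, a' ∈ toPFun a → b' ∈ toPFun b → a' ⊔ b' ∈ toPFun (a ⊔ b)
  himp_mem : ∀ {a b a' b' : L}, a' ∈ toPFun a → b' ∈ toPFun b → a' ⇨ b' ∈ toPFun (a ⇨ b)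

/-- The pointwise lifting of a partial endomorphism `g` of `L` to the set of homomorphisms
`A → L`: it is defined at `x` iff the range of `x` is contained in the domain of `g`,
and then its value at `x` is `g ∘ x`. -/
def PartialEndo.lift {L : Type} [HeytingAlgebra L] (g : PartialEndo L) (A : Type u)
    [HeytingAlgebra A] : HeytingHom A L →. HeytingHom A L := fun x =>
  ⟨∀ a, (g.toPFun (x a)).Dom, fun hx =>
    { toFun := fun a => (g.toPFun (x a)).get (hx a)
      map_sup' := fun a b => Part.get_eq_of_mem
        (by rw [map_sup]; exact g.sup_mem (Part.get_mem _) (Part.get_mem _)) _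
      map_inf' := fun a b => Part.get_eq_of_mem
        (by rw [map_inf]; exact g.inf_mem (Part.get_mem _) (Part.get_mem _)) _
      map_bot' := Part.get_eq_of_mem (by rw [map_bot]; exact g.bot_mem) _
      map_himp' := fun a b => Part.get_eq_of_mem
        (by rw [map_himp]; exact g.himp_mem (Part.get_mem _) (Part.get_mem _)) _ }⟩

/-- An alter ego of a finite Heyting algebra `L` (with the discrete topology), whose structure
consists of a family of partial endomorphisms indexed by `ι` and one endomorphism. -/
structure AlterEgo (L : Type) [HeytingAlgebra L] (ι : Type) where
  part : ι → PartialEndo L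
  total : HeytingHom L L

/-- Topological structures with `ι`-indexed unary partial operations and one unary
operation. -/
structure OpSpace (ι : Type) where
  carrier : Type u
  topology : TopologicalSpace carrier
  part : ι → carrier →. carrier
  total : carrier → carrier

instance (ι : Type) : CoeSort (OpSpace.{u} ι) (Type u) := ⟨OpSpace.carrier⟩

instance (ι : Type) (X : OpSpace.{u} ι) : TopologicalSpace X := X.topology

/-- Morphisms: continuous structure-preserving maps. -/
structure OpSpace.Hom {ι : Type} (X Y : OpSpace.{u} ι) where
  toFun : X → Y
  continuous_toFun : Continuous toFun
  map_part : ∀ (i : ι) (x x' : X), x' ∈ X.part i x → toFun x' ∈ Y.part i (toFun x)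
  map_total : ∀ x : X, toFun (X.total x) = Y.total (toFun x)

instance {ι : Type} (X Y : OpSpace.{u} ι) : CoeFun (X.Hom Y) (fun _ => X → Y) :=
  ⟨OpSpace.Hom.toFun⟩

/-- The relation `≃` on a structure `X`: `x ≃ y` iff `x` and `y` are joined by a finite
(possibly empty) sequence, each member of which is obtained from the preceding one, or
the preceding one from it, by applying one of the partial operations of `X`. -/
def OpSpace.Equivalent {ι : Type} (X : OpSpace.{u} ι) : X → X → Prop :=
  Relation.ReflTransGen fun z z' => ∃ i : ι, z' ∈ X.part i z ∨ z ∈ X.part i z'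

/-- The dual space of `A`: the set of homomorphisms `A → L`, as a topological substructure
of the power of the alter ego by the set `A`. -/
def AlterEgo.dual {L : Type} [HeytingAlgebra L] {ι : Type} (σ : AlterEgo L ι)
    (A : Type u) [HeytingAlgebra A] : OpSpace.{u} ι where
  carrier := HeytingHom A L
  topology := TopologicalSpace.induced (fun x a => x a)
    (@Pi.topologicalSpace A (fun _ => L) (fun _ => ⊥))
  part := fun i => (σ.part i).lift A
  total := fun x => σ.total.comp x

/-- The dual map of a homomorphism `f : A → B`, namely `x ↦ x ∘ f`. -/
def AlterEgo.dualMap {L : Type} [HeytingAlgebra L] {ι : Type} (σ : AlterEgo L ι)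
    {A B : Type u} [HeytingAlgebra A] [HeytingAlgebra B] (f : HeytingHom A B) :
    (σ.dual B).Hom (σ.dual A) where
  toFun := fun x : HeytingHom B L => HeytingHom.comp x f
  continuous_toFun := by
    let _ : TopologicalSpace L := ⊥
    refine continuous_induced_rng.2 (continuous_pi fun a => ?_)
    exact (continuous_apply (f a)).comp
      (continuous_induced_dom (f := fun (x : HeytingHom B L) (b : B) => x b))
  map_part := by
    rintro i x x' ⟨hx, rfl⟩
    exact ⟨fun a => hx (f a), rfl⟩
  map_total := fun _ => rfl

/-! The particular endomorphisms and partial endomorphisms of the chain. -/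

/-- The map `h_i` on the chain: `h_i x = x + 1` if `i ≤ x < n - 1` and `h_i x = x` otherwise. -/
def hFun (n i : ℕ) (x : Fin n) : Fin n :=
  ⟨if i ≤ x.val ∧ x.val < n - 1 then x.val + 1 else x.val, by
    have := x.isLt
    split_ifs <;> omega⟩

theorem hFun_mono (n i : ℕ) : Monotone (hFun n i) := by
  intro a b h
  rw [Fin.le_def] at *
  simp only [hFun]
  split_ifs <;> omega

/-- For `1 ≤ i`, the map `h_i` as an endomorphism of the chain. -/
def hEndo (n : ℕ) [NeZero n] (i : ℕ) (hi : 1 ≤ i) : HeytingHom (Fin n) (Fin n) where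
  toFun := hFun n i
  map_sup' := (hFun_mono n i).map_sup
  map_inf' := (hFun_mono n i).map_inf
  map_bot' := by
    have ht := chain_bot_val (n := n)
    rw [Fin.ext_iff]
    simp only [hFun]
    split_ifs <;> omega
  map_himp' := fun a b => by
    have ht := chain_top_val (n := n)
    have ha := a.isLt
    have hb := b.isLt
    have htop : hFun n i ⊤ = ⊤ := by
      rw [Fin.ext_iff]
      simp only [hFun, ht]
      split_ifs <;> omega
    rw [chain_himp, chain_himp]
    by_cases h : a ≤ b
    · rw [if_pos h, if_pos (hFun_mono n i h), htop]
    · rw [if_neg h]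
      by_cases h' : hFun n i a ≤ hFun n i b
      · rw [if_pos h', Fin.ext_iff, ht]
        rw [Fin.le_def] at h h'
        simp only [hFun] at *
        split_ifs at * <;> omega
      · rw [if_neg h']

/-- The map fixing every element of the chain except `i + 1`, which is sent to `i`. -/
def gFun (n i : ℕ) (x : Fin n) : Fin n :=
  ⟨if x.val = i + 1 then i else x.val, by
    have := x.isLt
    split_ifs <;> omega⟩

theorem gFun_mono (n i : ℕ) : Monotone (gFun n i) := by
  intro a b h
  rw [Fin.le_def] at *
  simp only [gFun]
  split_ifs <;> omega

/-- For `1 ≤ i ≤ n - 3`, the partial endomorphism `g_i` of the chain, with domain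
`{x | x ≠ i}`, sending `i + 1` to `i` and fixing every other element of the domain. -/
def gEndo (n : ℕ) [NeZero n] (i : ℕ) (hi : i ∈ Set.Icc 1 (n - 3)) : PartialEndo (Fin n) where
  toPFun := fun x => ⟨x.val ≠ i, fun _ => gFun n i x⟩
  bot_mem := by
    obtain ⟨h1, h2⟩ := hi
    have ht := chain_bot_val (n := n)
    refine ⟨fun h => by omega, ?_⟩
    rw [Fin.ext_iff]
    simp only [gFun, ht]
    rw [if_neg (by omega)]
  top_mem := by
    obtain ⟨h1, h2⟩ := hi
    have ht := chain_top_val (n := n)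
    refine ⟨fun h => by omega, ?_⟩
    rw [Fin.ext_iff]
    simp only [gFun, ht]
    rw [if_neg (by omega)]
  inf_mem := by
    rintro a b _ _ ⟨ha, rfl⟩ ⟨hb, rfl⟩
    refine ⟨?_, (gFun_mono n i).map_inf a b⟩
    rcases min_choice a b with h | h
    · exact fun h' => ha (h ▸ h')
    · exact fun h' => hb (h ▸ h')
  sup_mem := by
    rintro a b _ _ ⟨ha, rfl⟩ ⟨hb, rfl⟩
    refine ⟨?_, (gFun_mono n i).map_sup a b⟩
    rcases max_choice a b with h | h
    · exact fun h' => ha (h ▸ h')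
    · exact fun h' => hb (h ▸ h')
  himp_mem := by
    rintro a b _ _ ⟨ha, rfl⟩ ⟨hb, rfl⟩
    obtain ⟨h1, h2⟩ := hi
    have ht := chain_top_val (n := n)
    change a.val ≠ i at ha
    change b.val ≠ i at hb
    change gFun n i a ⇨ gFun n i b ∈ (⟨(a ⇨ b).val ≠ i, fun _ => gFun n i (a ⇨ b)⟩ : Part (Fin n))
    rw [chain_himp a b, chain_himp]
    by_cases h : a ≤ b
    · rw [if_pos h, if_pos (gFun_mono n i h)]
      refine ⟨fun h => by omega, ?_⟩
      rw [Fin.ext_iff]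
      simp only [gFun, ht]
      rw [if_neg (by omega)]
    · rw [if_neg h, if_neg]
      · exact ⟨hb, rfl⟩
      · rw [Fin.le_def] at *
        simp only [gFun]
        split_ifs <;> omega

/-- The alter ego of the `n`-element chain given by `σ = (g_1, …, g_{n-3}, h_1)`. -/
def sigma (n : ℕ) [NeZero n] : AlterEgo (Fin n) (Set.Icc 1 (n - 3)) where
  part := fun i => gEndo n i.1 i.2
  total := hEndo n 1 le_rfl

end Goedel

/-!
A homomorphism `x` into a chain is determined, up to `≃`, by the filter `x⁻¹(⊤)`: the preorder
`x a ≤ x b` can be read off it, since `x a ≤ x b` means `x (a ⇨ b) = ⊤`, and the operations `g_i`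
close the gaps in the range of `x` one at a time until, for every `b` outside the filter, `x b` is
the height of `b` in this preorder.

An embedding `B → D` in `ISP(C_n)` thus induces a map of dual spaces that meets every class of `≃`:
by compactness, each filter `x⁻¹(⊤)` on `B` is the trace of a filter of the same kind on `D`. So
the restrictions to `B` and `C` of the points of the dual of an amalgam give (a) and (b).
Conversely, the pairs `(y, z)` that agree on `A` are the coordinates of homomorphisms from `B` and
`C` to a common power of the chain, and these are injective once the `y` and the `z` represent
all classes.
-/

namespace Goedel

section TopKernel

variable {B D L : Type*} [HeytingAlgebra B] [HeytingAlgebra D] [HeytingAlgebra L]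

/-- The filter `x⁻¹(⊤)` of a homomorphism `x` of Heyting algebras, which determines the kernel
of `x`. -/
def topKernel (x : HeytingHom B L) : Set B := x ⁻¹' {⊤}

theorem mem_topKernel {x : HeytingHom B L} {b : B} : b ∈ topKernel x ↔ x b = ⊤ := Iff.rfl

theorem isUpperSet_topKernel (x : HeytingHom B L) : IsUpperSet (topKernel x) := by
  intro a b hab ha
  rw [mem_topKernel] at ha ⊢
  exact top_le_iff.1 (ha ▸ OrderHomClass.mono x hab)

theorem inf_mem_topKernel {x : HeytingHom B L} {a b : B} :
    a ⊓ b ∈ topKernel x ↔ a ∈ topKernel x ∧ b ∈ topKernel x := by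
  simp only [mem_topKernel, map_inf, inf_eq_top_iff]

theorem isCodirectedOrder_topKernel (x : HeytingHom B L) : IsCodirectedOrder (topKernel x) where
  directed b c := ⟨⟨b ⊓ c, inf_mem_topKernel.2 ⟨b.2, c.2⟩⟩, inf_le_left, inf_le_right⟩

theorem himp_mem_topKernel {x : HeytingHom B L} {a b : B} :
    a ⇨ b ∈ topKernel x ↔ x a ≤ x b := by
  rw [mem_topKernel, map_himp, himp_eq_top_iff]

theorem map_le_map_iff_of_topKernel_eq {x y : HeytingHom B L} (h : topKernel x = topKernel y)
    (a b : B) : x a ≤ x b ↔ y a ≤ y b := by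
  rw [← himp_mem_topKernel, h, himp_mem_topKernel]

theorem le_of_map_le_map {h : HeytingHom B D} (hh : Function.Injective h) {a b : B}
    (hab : h a ≤ h b) : a ≤ b :=
  himp_eq_top_iff.1 (hh (by rw [map_himp, map_top, himp_eq_top_iff.2 hab]))

theorem exists_ultralimit [Finite L] {ι : Type*} (U : Ultrafilter ι) (w : ι → HeytingHom D L) :
    ∃ v : HeytingHom D L, ∀ d, ∀ᶠ i in (U : Filter ι), w i d = v d := by
  have limit (d : D) : ∃ l : L, ∀ᶠ i in (U : Filter ι), w i d = l := by
    obtain ⟨l, hl⟩ := (U.map fun i => w i d).eq_pure_of_finite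
    have : {l} ∈ U.map fun i => w i d := hl ▸ Ultrafilter.mem_pure.2 rfl
    exact ⟨l, this⟩
  choose v hv using limit
  refine ⟨{ toFun := v, map_sup' := fun a b => ?_, map_inf' := fun a b => ?_, map_bot' := ?_,
            map_himp' := fun a b => ?_ }, hv⟩
  · obtain ⟨i, h, ha, hb⟩ := ((hv (a ⊔ b)).and ((hv a).and (hv b))).exists
    rw [← h, ← ha, ← hb, map_sup]
  · obtain ⟨i, h, ha, hb⟩ := ((hv (a ⊓ b)).and ((hv a).and (hv b))).exists
    rw [← h, ← ha, ← hb, map_inf]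
  · obtain ⟨i, h⟩ := (hv ⊥).exists
    rw [← h, map_bot]
  · obtain ⟨i, h, ha, hb⟩ := ((hv (a ⇨ b)).and ((hv a).and (hv b))).exists
    rw [← h, ← ha, ← hb, map_himp]

/-- The coordinate projections of a power of `L`. -/
def piEvalHom {J : Type*} (j : J) : HeytingHom (J → L) L where
  toFun f := f j
  map_sup' _ _ := rfl
  map_inf' _ _ := rfl
  map_bot' := rfl
  map_himp' _ _ := rfl

/-- The homomorphism into a power of `L` with the given coordinates. -/
def piHom {J : Type*} (p : J → HeytingHom B L) : HeytingHom B (J → L) where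
  toFun b j := p j b
  map_sup' a b := funext fun j => map_sup (p j) a b
  map_inf' a b := funext fun j => map_inf (p j) a b
  map_bot' := funext fun j => map_bot (p j)
  map_himp' a b := funext fun j => map_himp (p j) a b

end TopKernel

section Chain

attribute [local instance] LinearOrder.toBiheytingAlgebra

variable {B D L : Type*} [HeytingAlgebra B] [HeytingAlgebra D] [LinearOrder L] [BoundedOrder L]

theorem monotone_ite_le_top (a : L) : Monotone fun x : L => if a ≤ x then ⊤ else x := by
  intro x y hxy
  dsimp only
  split_ifs with hx hy
  · exact le_rfl
  · exact absurd (hx.trans hxy) hy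
  · exact le_top
  · exact hxy

/-- The endomorphism of a chain that collapses the filter generated by `a ≠ ⊥` to `⊤`. -/
def collapse (a : L) (ha : a ≠ ⊥) : HeytingHom L L where
  toFun x := if a ≤ x then ⊤ else x
  map_sup' := (monotone_ite_le_top a).map_sup
  map_inf' := (monotone_ite_le_top a).map_inf
  map_bot' := if_neg fun h => ha (le_bot_iff.1 h)
  map_himp' x y := by
    change (if a ≤ if x ≤ y then ⊤ else y then ⊤ else if x ≤ y then ⊤ else y) =
      if (if a ≤ x then ⊤ else x) ≤ (if a ≤ y then ⊤ else y) then ⊤ else if a ≤ y then ⊤ else y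
    by_cases hxy : x ≤ y
    · rw [if_pos hxy, if_pos le_top, if_pos (monotone_ite_le_top a hxy)]
    · rw [if_neg hxy]
      by_cases hy : a ≤ y
      · rw [if_pos hy, if_pos le_top]
      · have hle : ¬ (if a ≤ x then ⊤ else x) ≤ y := by
          split_ifs
          · exact fun h => hy (le_top.trans h)
          · exact hxy
        rw [if_neg hy, if_neg hle]

theorem collapse_eq_top_iff {a : L} (ha : a ≠ ⊥) (x : L) : collapse a ha x = ⊤ ↔ a ≤ x := by
  change (if a ≤ x then ⊤ else x) = ⊤ ↔ a ≤ x
  split_ifs with h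
  · exact iff_of_true rfl h
  · exact ⟨fun hx => hx ▸ le_top, fun hx => absurd hx h⟩

theorem sup_mem_topKernel {x : HeytingHom B L} {a b : B} :
    a ⊔ b ∈ topKernel x ↔ a ∈ topKernel x ∨ b ∈ topKernel x := by
  simp only [mem_topKernel, map_sup, max_eq_top]

theorem isDirectedOrder_compl_topKernel (x : HeytingHom B L) :
    IsDirectedOrder ↥(topKernel x)ᶜ where
  directed b c :=
    ⟨⟨b ⊔ c, fun hbc => (sup_mem_topKernel.1 hbc).elim b.2 c.2⟩, le_sup_left, le_sup_right⟩

theorem exists_topKernel_comp_eq_of_separated [Finite L] (h : HeytingHom B D)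
    (x : HeytingHom B L)
    (hsep : ∀ b ∈ topKernel x, ∀ c ∉ topKernel x,
      ∃ w : HeytingHom D L, b ∈ topKernel (w.comp h) ∧ c ∉ topKernel (w.comp h)) :
    ∃ w : HeytingHom D L, topKernel (w.comp h) = topKernel x := by
  rcases subsingleton_or_nontrivial L with _ | _
  · let w : HeytingHom D L :=
      { toFun := fun _ => ⊤
        map_sup' := fun _ _ => Subsingleton.elim _ _
        map_inf' := fun _ _ => Subsingleton.elim _ _
        map_bot' := Subsingleton.elim _ _
        map_himp' := fun _ _ => Subsingleton.elim _ _ }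
    exact ⟨w, Set.ext fun b => iff_of_true rfl (Subsingleton.elim (x b) ⊤)⟩
  -- Compactness: `topKernel x` is directed downwards and its complement upwards, so in the limit
  -- of the separating homomorphisms along these directions all conditions on `w` hold at once.
  have := isCodirectedOrder_topKernel x
  have := isDirectedOrder_compl_topKernel x
  have : Nonempty (topKernel x) := ⟨⊤, map_top x⟩
  have : Nonempty ↥(topKernel x)ᶜ := ⟨⊥, fun hbot => bot_ne_top ((map_bot x).symm.trans hbot)⟩
  choose w hw_mem hw_notMem using fun p : topKernel x × ↥(topKernel x)ᶜ =>
    hsep p.1 p.1.2 p.2 p.2.2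
  let F : Filter (topKernel x × ↥(topKernel x)ᶜ) := Filter.atBot ×ˢ Filter.atTop
  have hF : (Ultrafilter.of F : Filter _) ≤ F := Ultrafilter.of_le F
  obtain ⟨v, hv⟩ := exists_ultralimit (Ultrafilter.of F) w
  refine ⟨v, Set.ext fun b => ⟨fun hvb => ?_, fun hxb => ?_⟩⟩
  · by_contra hxb
    have hge : ∀ᶠ p in F, ⟨b, hxb⟩ ≤ p.2 := (Filter.eventually_ge_atTop _).prod_inr _
    obtain ⟨p, hp, hpv⟩ := ((hge.filter_mono hF).and (hv (h b))).exists
    exact hw_notMem p (isUpperSet_topKernel ((w p).comp h) hp (hpv.trans hvb))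
  · have hle : ∀ᶠ p in F, p.1 ≤ ⟨b, hxb⟩ := (Filter.eventually_le_atBot _).prod_inl _
    obtain ⟨p, hp, hpv⟩ := ((hle.filter_mono hF).and (hv (h b))).exists
    exact hpv.symm.trans (isUpperSet_topKernel ((w p).comp h) hp (hw_mem p))

/-- A homomorphism into a chain is gapless if its values below `⊤` are an initial segment of the
chain; each class of `≃` contains exactly one such homomorphism, its normal form. -/
def IsGapless (x : HeytingHom B L) : Prop := IsLowerSet (Set.range x \ {⊤})

theorem IsGapless.le_of_topKernel_eq [WellFoundedLT L] {x y : HeytingHom B L}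
    (hx : IsGapless x) (h : topKernel x = topKernel y) (b : B) : x b ≤ y b := by
  induction hv : x b using WellFoundedLT.induction generalizing b with
  | ind v ih =>
  subst hv
  by_contra! hlt
  obtain ⟨⟨c, hc⟩, -⟩ : y b ∈ Set.range x \ {⊤} := by
    refine hx hlt.le ⟨⟨b, rfl⟩, fun hb => hlt.ne ?_⟩
    rw [Set.mem_singleton_iff.1 hb, ← mem_topKernel, ← h]
    exact hb
  have hcb : ¬ y b ≤ y c := by
    rw [← map_le_map_iff_of_topKernel_eq h, hc]
    exact hlt.not_ge
  exact hcb (hc ▸ ih (x c) (hc ▸ hlt) c rfl)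

theorem IsGapless.eq_of_topKernel_eq [WellFoundedLT L] {x y : HeytingHom B L}
    (hx : IsGapless x) (hy : IsGapless y)
    (h : topKernel x = topKernel y) : x = y :=
  DFunLike.ext _ _ fun b => le_antisymm (hx.le_of_topKernel_eq h b)
    (hy.le_of_topKernel_eq h.symm b)

end Chain

section InG

variable {n : ℕ} [NeZero n] {B D : Type u} [HeytingAlgebra B] [HeytingAlgebra D]

theorem InG.exists_map_lt (hB : InG n B) {a b : B} (hab : ¬ a ≤ b) :
    ∃ x : HeytingHom B (Fin n), x b < x a := by
  obtain ⟨I, e, he⟩ := hB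
  have hle : ¬ e a ≤ e b := fun h => hab (le_of_map_le_map he h)
  obtain ⟨i, hi⟩ := not_forall.1 hle
  exact ⟨(piEvalHom i).comp e, not_le.1 hi⟩

theorem InG.exists_topKernel_comp_eq (hD : InG n D) {h : HeytingHom B D}
    (hh : Function.Injective h) (x : HeytingHom B (Fin n)) :
    ∃ w : HeytingHom D (Fin n), topKernel (w.comp h) = topKernel x := by
  refine exists_topKernel_comp_eq_of_separated h x fun b hb c hc => ?_
  have hbc : ¬ h b ≤ h c := fun hle => hc (isUpperSet_topKernel x (le_of_map_le_map hh hle) hb)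
  obtain ⟨w, hw⟩ := hD.exists_map_lt hbc
  have hbot : w (h b) ≠ ⊥ := hw.ne_bot
  exact ⟨(collapse _ hbot).comp w, (collapse_eq_top_iff hbot _).2 le_rfl,
    fun htop => hw.not_ge ((collapse_eq_top_iff hbot _).1 htop)⟩

theorem InG.injective_piHom (hB : InG n B) {J : Type*} (p : J → HeytingHom B (Fin n))
    (hp : ∀ x : HeytingHom B (Fin n), ∃ j, topKernel x = topKernel (p j)) :
    Function.Injective (piHom p) := by
  have le_of_eq {a b : B} (hab : piHom p a = piHom p b) : a ≤ b := by
    by_contra hle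
    obtain ⟨x, hx⟩ := hB.exists_map_lt hle
    obtain ⟨j, hj⟩ := hp x
    exact hx.not_ge ((map_le_map_iff_of_topKernel_eq hj a b).2 (congrFun hab j).le)
  exact fun a b hab => le_antisymm (le_of_eq hab) (le_of_eq hab.symm)

end InG

theorem OpSpace.Equivalent.symm {ι : Type} {X : OpSpace.{u} ι} {x y : X}
    (h : X.Equivalent x y) : X.Equivalent y x :=
  have : Std.Symm fun z z' : X => ∃ i : ι, z' ∈ X.part i z ∨ z ∈ X.part i z' :=
    ⟨fun _ _ ⟨i, hi⟩ => ⟨i, hi.symm⟩⟩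
  Relation.ReflTransGen.stdSymm.symm _ _ h

theorem gFun_le (i : ℕ) (v : Fin n) : gFun n i v ≤ v := by
  rw [Fin.le_def]
  simp only [gFun]
  split_ifs <;> omega

section Equivalent

variable {n : ℕ} [NeZero n] {B : Type u} [HeytingAlgebra B]

theorem gFun_eq_top_iff {i : ℕ} (hi : i ∈ Set.Icc 1 (n - 3)) (v : Fin n) :
    gFun n i v = ⊤ ↔ v = ⊤ := by
  obtain ⟨h1, h2⟩ := hi
  have := v.isLt
  simp only [Fin.ext_iff, chain_top_val, gFun]
  split_ifs <;> omega

theorem topKernel_eq_of_mem_part {i : Set.Icc 1 (n - 3)} {x y : HeytingHom B (Fin n)}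
    (h : y ∈ ((sigma n).dual B).part i x) : topKernel x = topKernel y := by
  obtain ⟨_, rfl⟩ := h
  exact Set.ext fun b => (gFun_eq_top_iff i.2 (x b)).symm

theorem topKernel_eq_of_equivalent {x y : HeytingHom B (Fin n)}
    (h : ((sigma n).dual B).Equivalent x y) : topKernel x = topKernel y := by
  induction h with
  | refl => rfl
  | tail _ hstep ih =>
    obtain ⟨i, hi | hi⟩ := hstep
    · exact ih.trans (topKernel_eq_of_mem_part hi)
    · exact ih.trans (topKernel_eq_of_mem_part hi).symm

theorem isGapless_of_forall_mem_Icc {x : HeytingHom B (Fin n)}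
    (hx : ∀ i ∈ Set.Icc 1 (n - 3), ∀ b, (x b).val = i + 1 → ∃ c, (x c).val = i) :
    IsGapless x := by
  rintro _ v hv ⟨⟨b, rfl⟩, hb⟩
  refine ⟨?_, fun htop => hb (top_le_iff.1 (htop ▸ hv))⟩
  rw [Set.mem_singleton_iff, Fin.ext_iff, chain_top_val] at hb
  rw [Fin.le_def] at hv
  induction hk : (x b).val generalizing b with
  | zero => exact ⟨⊥, by rw [map_bot, Fin.ext_iff, chain_bot_val]; omega⟩
  | succ k ih =>
    have := (x b).isLt
    rcases hv.eq_or_lt with heq | hlt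
    · exact ⟨b, Fin.ext heq.symm⟩
    rcases Nat.eq_zero_or_pos k with rfl | hpos
    · exact ⟨⊥, by rw [map_bot, Fin.ext_iff, chain_bot_val]; omega⟩
    obtain ⟨c, hc⟩ := hx k ⟨hpos, by omega⟩ b hk
    exact ih c (by omega) (by omega) hc

theorem exists_isGapless_equivalent (x : HeytingHom B (Fin n)) :
    ∃ y : HeytingHom B (Fin n), IsGapless y ∧ ((sigma n).dual B).Equivalent x y := by
  -- Applying `g_i` to `φ ∘ x` replaces `φ` by `g_i ∘ φ`, so a minimal `φ` leaves no gap to close.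
  let S : Set (Fin n → Fin n) :=
    {φ | ∃ y : HeytingHom B (Fin n), ((sigma n).dual B).Equivalent x y ∧ ∀ b, y b = φ (x b)}
  obtain ⟨φ, ⟨y, hxy, hy⟩, hmin⟩ :=
    S.toFinite.exists_minimal ⟨id, x, Relation.ReflTransGen.refl, fun _ => rfl⟩
  refine ⟨y, isGapless_of_forall_mem_Icc fun i hi b hb => ?_, hxy⟩
  by_contra! hgap
  let z : HeytingHom B (Fin n) := ((gEndo n i hi).lift B y).get hgap
  have hyz : z ∈ ((sigma n).dual B).part ⟨i, hi⟩ y := ⟨hgap, rfl⟩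
  have hz : gFun n i ∘ φ ∈ S :=
    ⟨z, hxy.tail ⟨⟨i, hi⟩, Or.inl hyz⟩, fun c => congrArg (gFun n i) (hy c)⟩
  have hle : φ (x b) ≤ gFun n i (φ (x b)) := hmin hz (fun v => gFun_le i (φ v)) (x b)
  rw [← hy, Fin.le_def] at hle
  simp only [gFun, if_pos hb] at hle
  omega

theorem equivalent_iff_topKernel_eq {x y : HeytingHom B (Fin n)} :
    ((sigma n).dual B).Equivalent x y ↔ topKernel x = topKernel y := by
  refine ⟨topKernel_eq_of_equivalent, fun h => ?_⟩
  obtain ⟨x', hx', hxx'⟩ := exists_isGapless_equivalent x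
  obtain ⟨y', hy', hyy'⟩ := exists_isGapless_equivalent y
  have hker : topKernel x' = topKernel y' :=
    (topKernel_eq_of_equivalent hxx').symm.trans (h.trans (topKernel_eq_of_equivalent hyy'))
  obtain rfl : x' = y' := hx'.eq_of_topKernel_eq hy' hker
  exact hxx'.trans hyy'.symm

end Equivalent

section Amalgamation

variable {n : ℕ} [NeZero n] {A B C : Type u} [HeytingAlgebra A] [HeytingAlgebra B]
  [HeytingAlgebra C] {fB : HeytingHom A B} {fC : HeytingHom A C}

theorem AdmitsAmalgamation.symm (h : AdmitsAmalgamation n fB fC) :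
    AdmitsAmalgamation n fC fB := by
  obtain ⟨D, i, hD, hB, hC, hBi, hCi, hcomm⟩ := h
  exact ⟨D, i, hD, hC, hB, hCi, hBi, hcomm.symm⟩

theorem AdmitsAmalgamation.exists_equivalent (h : AdmitsAmalgamation n fB fC)
    (x : (sigma n).dual B) :
    ∃ (y : (sigma n).dual B) (z : (sigma n).dual C), ((sigma n).dual B).Equivalent x y ∧
      (sigma n).dualMap fB y = (sigma n).dualMap fC z := by
  obtain ⟨D, _, hD, hB, hC, hBi, -, hcomm⟩ := h
  obtain ⟨w, hw⟩ := hD.exists_topKernel_comp_eq hBi x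
  have hagree : (w.comp hB).comp fB = (w.comp hC).comp fC := by
    rw [HeytingHom.comp_assoc, HeytingHom.comp_assoc, hcomm]
  exact ⟨w.comp hB, w.comp hC, equivalent_iff_topKernel_eq.2 hw.symm, hagree⟩

theorem admitsAmalgamation_of_exists_equivalent (hB : InG n B) (hC : InG n C)
    (hfB : ∀ x : (sigma n).dual B, ∃ (y : (sigma n).dual B) (z : (sigma n).dual C),
      ((sigma n).dual B).Equivalent x y ∧ (sigma n).dualMap fB y = (sigma n).dualMap fC z)
    (hfC : ∀ x : (sigma n).dual C, ∃ (y : (sigma n).dual C) (z : (sigma n).dual B),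
      ((sigma n).dual C).Equivalent x y ∧ (sigma n).dualMap fC y = (sigma n).dualMap fB z) :
    AdmitsAmalgamation n fB fC := by
  let J : Type u :=
    Function.Pullback ((sigma n).dualMap fB).toFun ((sigma n).dualMap fC).toFun
  let p (j : J) : HeytingHom B (Fin n) := j.fst
  let q (j : J) : HeytingHom C (Fin n) := j.snd
  have hp : Function.Injective (piHom p) := hB.injective_piHom p fun x => by
    obtain ⟨y, z, hxy, hyz⟩ := hfB x
    exact ⟨⟨(y, z), hyz⟩, topKernel_eq_of_equivalent hxy⟩
  have hq : Function.Injective (piHom q) := hC.injective_piHom q fun x => by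
    obtain ⟨y, z, hxy, hyz⟩ := hfC x
    exact ⟨⟨(z, y), hyz.symm⟩, topKernel_eq_of_equivalent hxy⟩
  have hagree (j : J) : (p j).comp fB = (q j).comp fC := j.2
  have hcomm : (piHom p).comp fB = (piHom q).comp fC :=
    DFunLike.ext _ _ fun a => funext fun j => DFunLike.congr_fun (hagree j) a
  exact ⟨J → Fin n, inferInstance, ⟨J, HeytingHom.id _, Function.injective_id⟩,
    piHom p, piHom q, hp, hq, hcomm⟩

end Amalgamation

end Goedel

theorem theorem6p4_general {n : ℕ} [NeZero n] {A B C : Type u}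
    [HeytingAlgebra A] [HeytingAlgebra B] [HeytingAlgebra C]
    (hB : Goedel.InG n B) (hC : Goedel.InG n C)
    (fB : HeytingHom A B) (fC : HeytingHom A C) :
    Goedel.AdmitsAmalgamation n fB fC ↔
      ((∀ x : (Goedel.sigma n).dual B,
          ∃ (y : (Goedel.sigma n).dual B) (z : (Goedel.sigma n).dual C),
            ((Goedel.sigma n).dual B).Equivalent x y ∧
              (Goedel.sigma n).dualMap fB y = (Goedel.sigma n).dualMap fC z) ∧
        (∀ x' : (Goedel.sigma n).dual C,
          ∃ (y' : (Goedel.sigma n).dual C) (z' : (Goedel.sigma n).dual B),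
            ((Goedel.sigma n).dual C).Equivalent x' y' ∧
              (Goedel.sigma n).dualMap fC y' = (Goedel.sigma n).dualMap fB z')) :=
  ⟨fun h => ⟨h.exists_equivalent, h.symm.exists_equivalent⟩,
    fun ⟨hfB, hfC⟩ => Goedel.admitsAmalgamation_of_exists_equivalent hB hC hfB hfC⟩

theorem theorem6p4 (n : ℕ) [NeZero n] (hn : 4 ≤ n) {A B C : Type u}
    [HeytingAlgebra A] [HeytingAlgebra B] [HeytingAlgebra C]
    (hA : Goedel.InG n A) (hB : Goedel.InG n B) (hC : Goedel.InG n C)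
    (fB : HeytingHom A B) (fC : HeytingHom A C)
    (hfB : Function.Injective fB) (hfC : Function.Injective fC) :
    Goedel.AdmitsAmalgamation n fB fC ↔
      ((∀ x : (Goedel.sigma n).dual B,
          ∃ (y : (Goedel.sigma n).dual B) (z : (Goedel.sigma n).dual C),
            ((Goedel.sigma n).dual B).Equivalent x y ∧
              (Goedel.sigma n).dualMap fB y = (Goedel.sigma n).dualMap fC z) ∧
        (∀ x' : (Goedel.sigma n).dual C,
          ∃ (y' : (Goedel.sigma n).dual C) (z' : (Goedel.sigma n).dual B),
            ((Goedel.sigma n).dual C).Equivalent x' y' ∧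
              (Goedel.sigma n).dualMap fC y' = (Goedel.sigma n).dualMap fB z')) :=
  theorem6p4_general hB hC fB fC
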